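/- **Setting.** Let $k\ge 0$ be an integer, $T>0$, $u_0\in\mathbb R$ and $f:\mathbb R\times\mathbb R\to\mathbb R$; consider $u'(t)=f(t,u(t))$ on $[0,T]$, $u(0)=u_0$. For a partition $0=t_0<t_1<\dots<t_N=T$ put $I_n=(t_{n-1},t_n)$, $h=\max_n(t_n-t_{n-1})$. With $P_\ell$ the Legendre polynomials ($P_\ell(1)=1$) let $$R_{k+1}=\tfrac12P_{k+1}(-1)P_{k+1}+\tfrac12P_k(-1)P_k,\qquad \mathcal R_{n,k+1}(t)=R_{k+1}\Big(\frac{2t-(t_n+t_{n-1})}{t_n-t_{n-1}}\Big)$$ be the left-Radau polynomial and its scaling to $I_n$, and let $\mathcal I_Rg$ denote, on $I_n$, the Lagrange interpolant of degree at most $k$ of $g$ at the zeros of $\mathcal R_{n,k+1}$ (the Radau zeros). $\mathcal P_m(I_n)$ is the space of polynomials of degree at most $m$ on $I_n$. *CG method.* $u_h^{\rm CG}|_{I_n}\in\mathcal P_{k+1}(I_n)$ satisfies, for all $n$, $\int_{I_n}v\,\frac{d}{dt}u_h^{\rm CG}\,dt=\int_{I_n}\mathcal I_R f(\cdot,u_h^{\rm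 CG})\,v\,dt$ for all $v\in\mathcal P_k(I_n)$ and $u_h^{\rm CG}(t_{n-1}^+)=u_h^{\rm CG}(t_{n-1}^-)$, where $u_h^{\rm CG}(0^-):=u_0$. *DG method.* $u_h^{\rm DG}|_{I_n}\in\mathcal P_k(I_n)$ satisfies, for all $n$ and all $v\in\mathcal P_k(I_n)$, $$-\int_{I_n}u_h^{\rm DG}v'\,dt+\widehat u_h(t_n)v(t_n)-\widehat u_h(t_{n-1})v(t_{n-1})=\int_{I_n}\mathcal I_Rf(\cdot,u_h^{\rm DG})\,v\,dt,$$ where $\widehat u_h(t_m)=u_h^{\rm DG}(t_m^-)$ and $u_h^{\rm DG}(0^-):=u_0$. Its post-processing is, on $I_n$, $u_h^{{\rm DG},*}=u_h^{\rm DG}+\big(\widehat u_h(t_{n-1})-u_h^{\rm DG}(t_{n-1}^+)\big)\mathcal R_{n,k+1}$. **Corollary 3.1.** *(A)* On every partition, $\mathcal R_{n,k+1}$ has exactly $k+1$ distinct real zeros for each $n$, all of them in $(t_{n-1},t_n]$, and $u_h^{\rm DG}\mapsto u_h^{{\rm DG},*}$ is a bijection from the set of solutions of the DG method onto the set of solutions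 of the CG method. *(B)* Let $u\in C^{k+3}([0,T])$ be a solution of the initial value problem (with one-sided derivatives at $0$ and $T$), let $\delta\in(0,\infty]$ and $L\ge0$, and suppose that for every $t\in[0,T]$ the function $f(t,\cdot)$ is $L$-Lipschitz on $\{x:|x-u(t)|\le\delta\}$ (for $\delta=\infty$: on $\mathbb R$). Then there are $h_0>0$ and $K$, independent of the partition, such that for every partition with $h\le h_0$ the DG method and the CG method each have exactly one solution, $u_h^{\rm DG}$ and $u_h^{\rm CG}$, whose distance to $u$ at all Radau zeros is at most $\delta$ (for $\delta=\infty$: exactly one solution), and: 1. $u_h^{{\rm DG},*}=u_h^{\rm CG}$ on every $I_n$; 2. if $k>0$, then $|u_h^{{\rm DG},*}(t)-u(t)|\le K\,h^{k+2}$ for all $n$ and all $t\in[t_{n-1},t_n]$, where on $[t_{n-1},t_n]$ the polynomial of $I_n$ is taken; 3. if $k>0$, then $|u_h^{\rm DG}(t_\ell)-u(t_\ell)|\le K\,h^{k+2}$ at all $k+1$ zeros $t_\ell$ of $\mathcal R_{n,k+1}$, for all $n$, where $u_h^{\rm DG}$ is the polynomial of $I_n$. -/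

import Mathlib

open Set Polynomial
open scoped NNReal ENNReal

noncomputable section

namespace Galerkin

/-- The Legendre polynomial `P_ℓ` (Rodrigues' formula, normalised by `P_ℓ(1) = 1`). -/
def legendre (l : ℕ) : ℝ[X] :=
  C (1 / (2 ^ l * (l.factorial : ℝ))) * derivative^[l] ((X ^ 2 - 1) ^ l)

/-- The left-Radau polynomial of degree `k + 1` on `[-1, 1]`:
`R_{k+1} = ½ P_{k+1}(-1) P_{k+1} + ½ P_k(-1) P_k`. -/
def leftRadau (k : ℕ) : ℝ[X] :=
  C (1 / 2 * (legendre (k + 1)).eval (-1)) * legendre (k + 1)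
    + C (1 / 2 * (legendre k).eval (-1)) * legendre k

/-- The left-Radau polynomial of degree `k + 1` scaled to the interval `(a, b)`:
`t ↦ R_{k+1}(τ(t))` with `τ(t) = (2 t - (b + a)) / (b - a)`. -/
def scaledRadau (k : ℕ) (a b : ℝ) : ℝ[X] :=
  (leftRadau k).comp (C (1 / (b - a)) * (2 * X - C (b + a)))

/-- The real zeros of the scaled left-Radau polynomial. -/
def radauZeros (k : ℕ) (a b : ℝ) : Finset ℝ := (scaledRadau k a b).roots.toFinset

/-- The Lagrange interpolant `I_R g` of `g` at the zeros of the scaled left-Radau polynomial. -/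
def radauInterp (k : ℕ) (a b : ℝ) (g : ℝ → ℝ) : ℝ[X] :=
  Lagrange.interpolate (radauZeros k a b) id g

/-- `0 = t_0 < t_1 < ⋯ < t_N = T`. -/
structure IsPartition (T : ℝ) {N : ℕ} (t : Fin (N + 1) → ℝ) : Prop where
  strictMono : StrictMono t
  first : t 0 = 0
  last : t (Fin.last N) = T

/-- The largest step of a partition. -/
def meshSize {N : ℕ} (t : Fin (N + 1) → ℝ) : ℝ := ⨆ n : Fin N, (t n.succ - t n.castSucc)

/-- A piecewise polynomial is given by one polynomial `U n` for each interval
`(t n.castSucc, t n.succ)`. Its left traces at the nodes are `u₀` at `t 0` and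
the value `U n (t n.succ)` at the right end of each interval. For the DG method
this is the upwinding numerical trace. -/
def leftTrace {N : ℕ} (t : Fin (N + 1) → ℝ) (u₀ : ℝ) (U : Fin N → ℝ[X]) : Fin (N + 1) → ℝ :=
  Fin.cases u₀ fun n => (U n).eval (t n.succ)

/-- `W` solves the CG method of degree `k + 1` for `u' = f(t, u)`, `u(0) = u₀`, with
`f(·, W(·))` replaced by its Lagrange interpolant at the Radau zeros. -/
structure IsCGSolution (k : ℕ) {N : ℕ} (t : Fin (N + 1) → ℝ) (u₀ : ℝ) (f : ℝ → ℝ → ℝ)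
    (W : Fin N → ℝ[X]) : Prop where
  natDegree_le : ∀ n, (W n).natDegree ≤ k + 1
  weak : ∀ n, ∀ v : ℝ[X], v.natDegree ≤ k →
    ∫ s in (t n.castSucc)..(t n.succ), v.eval s * (derivative (W n)).eval s =
      ∫ s in (t n.castSucc)..(t n.succ),
        (radauInterp k (t n.castSucc) (t n.succ) fun r => f r ((W n).eval r)).eval s * v.eval s
  continuous_at_nodes : ∀ n, (W n).eval (t n.castSucc) = leftTrace t u₀ W n.castSucc

/-- `U` solves the DG method of degree `k` (with upwinding numerical trace) for
`u' = f(t, u)`, `u(0) = u₀`, with `f(·, U(·))` replaced by its Lagrange interpolant at the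
Radau zeros. -/
structure IsDGSolution (k : ℕ) {N : ℕ} (t : Fin (N + 1) → ℝ) (u₀ : ℝ) (f : ℝ → ℝ → ℝ)
    (U : Fin N → ℝ[X]) : Prop where
  natDegree_le : ∀ n, (U n).natDegree ≤ k
  weak : ∀ n, ∀ v : ℝ[X], v.natDegree ≤ k →
    -(∫ s in (t n.castSucc)..(t n.succ), (U n).eval s * (derivative v).eval s)
        + (leftTrace t u₀ U n.succ * v.eval (t n.succ)
            - leftTrace t u₀ U n.castSucc * v.eval (t n.castSucc)) =
      ∫ s in (t n.castSucc)..(t n.succ),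
        (radauInterp k (t n.castSucc) (t n.succ) fun r => f r ((U n).eval r)).eval s * v.eval s

/-- The elementwise post-processing: on each interval, the jump (numerical trace minus
value) at the left end times the scaled left-Radau polynomial is added. -/
def postProcess (k : ℕ) {N : ℕ} (t : Fin (N + 1) → ℝ) (u₀ : ℝ) (U : Fin N → ℝ[X]) :
    Fin N → ℝ[X] := fun n =>
  U n + C (leftTrace t u₀ U n.castSucc - (U n).eval (t n.castSucc))
    * scaledRadau k (t n.castSucc) (t n.succ)

/-- The piecewise polynomial `V` is within distance `δ ∈ [0, ∞]` of `u` at all Radau zeros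
of all intervals (no condition if `δ = ∞`). -/
def IsNear (k : ℕ) {N : ℕ} (t : Fin (N + 1) → ℝ) (u : ℝ → ℝ) (δ : ℝ≥0∞)
    (V : Fin N → ℝ[X]) : Prop :=
  ∀ n, ∀ z ∈ radauZeros k (t n.castSucc) (t n.succ), edist ((V n).eval z) (u z) ≤ δ

end Galerkin

end

/-!
The CG method is a collocation method: `W'` and `I_R f(·, W)` both have degree at most `k`, so
testing with all polynomials of degree at most `k` says `W' = I_R f(·, W)` on every interval
(`isCGSolution_iff`). The scaled Radau polynomial `R` is `1` at the left end of the interval, `0`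
at the right end, and orthogonal to all polynomials of degree less than `k`. Integration by parts
therefore turns the DG form of `U` into the CG form of `U + c R`, where `c` is the jump at the left
end, while the right-hand side is not changed because `R` vanishes at the interpolation points
(`isDGSolution_iff`, `bijOn_postProcess`). Conversely, a CG solution determines `c` by its leading
coefficient. Orthogonality also gives the zeros: if `R` had fewer than `k` zeros in the open
interval, its product with linear factors compensating the sign changes would have
integral zero without changing sign (`card_radauZeros_and_mem`).

For part (B), `f` is replaced by a right-hand side `g` that is Lipschitz on all of `ℝ` and agrees
with `f` near `u`; solutions near `u` are the same for both. For `g` and small steps the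
collocation equations on one interval are a contraction for the values at the Radau zeros, by the
scale-invariant bound `exists_isLebesgueBound` (`existsUnique_isCollocation`). On one interval the
error `e = W - u` satisfies `e' = I_R (g(·, W) - g(·, u)) + (I_R u' - u')`. The last term is
`O(h ^ (k + 1))`, which contributes `O(h ^ (k + 2))` inside the interval. For `k > 0` its main part
is a multiple of `R`, which has mean value zero, so that `O(h ^ (k + 3))` remains at the right end
(`exists_interpolation_bound`, `abs_eval_sub_le`). Only the Lipschitz continuity of `g`
is used here. The discrete Gronwall inequality gives `O(h ^ (k + 2))` at the nodes and hence
everywhere (`exists_error_bound`). For `k = 0` the same argument gives first order, which suffices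
to show that the solution for `g` is near `u` and so is a solution for `f`. The DG statements
follow since `U` and its post-processing agree at the Radau zeros.
-/

namespace Galerkin

/-! ### Integration of polynomials -/

theorem intervalIntegrable_eval (p : ℝ[X]) (a b : ℝ) :
    IntervalIntegrable (fun s => p.eval s) MeasureTheory.volume a b :=
  p.continuous.intervalIntegrable a b

theorem integral_eval_derivative (p : ℝ[X]) (a b : ℝ) :
    ∫ s in a..b, (derivative p).eval s = p.eval b - p.eval a :=
  intervalIntegral.integral_eq_sub_of_hasDerivAt (fun x _ => p.hasDerivAt x)
    (intervalIntegrable_eval _ a b)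

theorem integral_eval_derivative_mul (p q : ℝ[X]) (a b : ℝ) :
    ∫ s in a..b, (derivative p).eval s * q.eval s =
      p.eval b * q.eval b - p.eval a * q.eval a
        - ∫ s in a..b, p.eval s * (derivative q).eval s := by
  have h := integral_eval_derivative (p * q) a b
  simp only [derivative_mul, eval_add, eval_mul] at h
  rw [intervalIntegral.integral_add] at h
  · linarith
  · simpa using intervalIntegrable_eval (derivative p * q) a b
  · simpa using intervalIntegrable_eval (p * derivative q) a b

/-- A polynomial of constant sign on an interval of positive length is zero as soon as its
integral vanishes. -/
theorem eq_zero_of_integral_eq_zero {p : ℝ[X]} {a b : ℝ} (hab : a < b)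
    (hp : ∀ s ∈ Ioo a b, 0 ≤ p.eval s) (h : ∫ s in a..b, p.eval s = 0) : p = 0 := by
  have hp' : ∀ s ∈ Icc a b, 0 ≤ p.eval s := by
    have hcl : IsClosed {s : ℝ | 0 ≤ p.eval s} := isClosed_le continuous_const p.continuous
    rw [← closure_Ioo hab.ne]
    exact closure_minimal hp hcl
  by_contra hne
  obtain ⟨c, hc, hc0⟩ : ∃ c ∈ Icc a b, p.eval c ≠ 0 := by
    by_contra! hcon
    exact hne (eq_zero_of_infinite_isRoot p ((Icc_infinite hab).mono fun s hs => hcon s hs))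
  have := intervalIntegral.integral_pos hab p.continuous.continuousOn
    (fun x hx => hp' x (Ioc_subset_Icc_self hx))
    ⟨c, hc, lt_of_le_of_ne (hp' c hc) (Ne.symm hc0)⟩
  linarith

/-! ### Legendre polynomials -/

theorem eval_iterate_derivative_pow_mul (l : ℕ) (a : ℝ) (G : ℝ[X]) :
    (derivative^[l] ((X - C a) ^ l * G)).eval a = l.factorial * G.eval a := by
  induction l generalizing G with
  | zero => simp
  | succ l ih =>
    have : derivative ((X - C a) ^ (l + 1) * G)
        = (X - C a) ^ l * (C ((l : ℝ) + 1) * G + (X - C a) * derivative G) := by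
      simp only [derivative_mul, derivative_X_sub_C_pow, Nat.add_sub_cancel]
      simp only [Nat.cast_add, Nat.cast_one, map_add, map_natCast, map_one]
      ring
    rw [Function.iterate_succ_apply, this, ih]
    simp [Nat.factorial_succ]
    ring

theorem X_sq_sub_one_pow (l : ℕ) :
    ((X : ℝ[X]) ^ 2 - 1) ^ l = (X - C 1) ^ l * (X - C (-1)) ^ l := by
  rw [← mul_pow]; congr 1; simp; ring

theorem legendre_eval_one (l : ℕ) : (legendre l).eval 1 = 1 := by
  rw [legendre, eval_mul, eval_C, X_sq_sub_one_pow, eval_iterate_derivative_pow_mul]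
  have : (l.factorial : ℝ) ≠ 0 := by positivity
  simp
  norm_num
  field_simp

theorem legendre_eval_neg_one (l : ℕ) : (legendre l).eval (-1) = (-1) ^ l := by
  rw [legendre, eval_mul, eval_C, X_sq_sub_one_pow, mul_comm ((X - C (1 : ℝ)) ^ l),
    eval_iterate_derivative_pow_mul]
  have : (l.factorial : ℝ) ≠ 0 := by positivity
  have h2 : (-1 - 1 : ℝ) = (-1) * 2 := by norm_num
  simp only [eval_pow, eval_sub, eval_X, eval_C, h2, mul_pow]
  field_simp

theorem natDegree_legendre_le (l : ℕ) : (legendre l).natDegree ≤ l := by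
  refine (natDegree_C_mul_le _ _).trans ((natDegree_iterate_derivative _ _).trans ?_)
  have : ((X : ℝ[X]) ^ 2 - 1).natDegree = 2 := by compute_degree!
  rw [natDegree_pow, this]
  omega

/-- The `n`-th derivative of a multiple of `(X² - 1)ⁿ` is orthogonal on `[-1, 1]` to all
polynomials of degree less than `n`: integrate by parts `n` times. -/
theorem integral_iterate_derivative_mul_eq_zero (n : ℕ) {F q : ℝ[X]}
    (hF : ((X : ℝ[X]) ^ 2 - 1) ^ n ∣ F) (hq : q.degree < n) :
    ∫ s in (-1 : ℝ)..1, (derivative^[n] F).eval s * q.eval s = 0 := by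
  induction n generalizing q with
  | zero =>
    have : q = 0 := by simpa using hq
    simp [this]
  | succ n ih =>
    have hroot : ∀ a : ℝ, (X - C a) ^ (n + 1) ∣ F → (derivative^[n] F).eval a = 0 := by
      intro a ha
      have h := pow_sub_dvd_iterate_derivative_of_pow_dvd n ha
      simpa [dvd_iff_isRoot] using h
    rw [X_sq_sub_one_pow] at hF
    have h1 := hroot 1 ((dvd_mul_right _ _).trans hF)
    have h2 := hroot (-1) ((dvd_mul_left _ _).trans hF)
    rw [Function.iterate_succ_apply', integral_eval_derivative_mul, h1, h2, ih]
    · simp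
    · rw [X_sq_sub_one_pow]
      exact (mul_dvd_mul (pow_dvd_pow _ n.le_succ) (pow_dvd_pow _ n.le_succ)).trans hF
    · by_cases h0 : q = 0
      · simp [h0]
      · have h3 := degree_derivative_lt h0
        have h4 : q.degree ≤ n := by
          rw [← natDegree_le_iff_degree_le]
          rw [degree_lt_iff_coeff_zero] at hq
          exact natDegree_le_iff_coeff_eq_zero.2 fun m hm => hq m hm
        exact h3.trans_le h4

theorem integral_legendre_mul_eq_zero {l : ℕ} {q : ℝ[X]} (hq : q.degree < l) :
    ∫ s in (-1 : ℝ)..1, (legendre l).eval s * q.eval s = 0 := by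
  simp only [legendre, eval_mul, eval_C, mul_assoc]
  rw [intervalIntegral.integral_const_mul, integral_iterate_derivative_mul_eq_zero l dvd_rfl hq,
    mul_zero]

/-! ### The Radau polynomial -/

theorem leftRadau_eval_one (k : ℕ) : (leftRadau k).eval 1 = 0 := by
  simp [leftRadau, legendre_eval_one, legendre_eval_neg_one, pow_succ]

theorem leftRadau_eval_neg_one (k : ℕ) : (leftRadau k).eval (-1) = 1 := by
  have : ((-1 : ℝ) ^ k) * (-1) ^ k = 1 := by rw [← mul_pow]; simp
  simp [leftRadau, legendre_eval_neg_one, pow_succ]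
  linarith

theorem natDegree_leftRadau_le (k : ℕ) : (leftRadau k).natDegree ≤ k + 1 := by
  refine natDegree_add_le_of_degree_le ((natDegree_C_mul_le _ _).trans (natDegree_legendre_le _))
    ((natDegree_C_mul_le _ _).trans ((natDegree_legendre_le _).trans k.le_succ))

theorem integral_leftRadau_mul_eq_zero {k : ℕ} {q : ℝ[X]} (hq : q.degree < k) :
    ∫ s in (-1 : ℝ)..1, (leftRadau k).eval s * q.eval s = 0 := by
  have h1 : q.degree < ((k + 1 : ℕ) : WithBot ℕ) :=
    hq.trans (by exact_mod_cast k.lt_succ_self)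
  simp only [leftRadau, eval_add, eval_mul, eval_C, add_mul, mul_assoc]
  rw [intervalIntegral.integral_add]
  · simp only [intervalIntegral.integral_const_mul, integral_legendre_mul_eq_zero hq,
      integral_legendre_mul_eq_zero h1, mul_zero, add_zero]
  · exact Continuous.intervalIntegrable (by fun_prop) _ _
  · exact Continuous.intervalIntegrable (by fun_prop) _ _

theorem scaledRadau_eval (k : ℕ) (a b s : ℝ) :
    (scaledRadau k a b).eval s = (leftRadau k).eval ((2 * s - (b + a)) / (b - a)) := by
  simp [scaledRadau, eval_comp]
  congr 1
  ring

theorem scaledRadau_eval_left {k : ℕ} {a b : ℝ} (hab : a < b) :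
    (scaledRadau k a b).eval a = 1 := by
  have : b - a ≠ 0 := (sub_pos.2 hab).ne'
  rw [scaledRadau_eval, ← leftRadau_eval_neg_one k]
  congr 1
  field_simp
  ring

theorem scaledRadau_eval_right {k : ℕ} {a b : ℝ} (hab : a < b) :
    (scaledRadau k a b).eval b = 0 := by
  have : b - a ≠ 0 := (sub_pos.2 hab).ne'
  rw [scaledRadau_eval, ← leftRadau_eval_one k]
  congr 1
  field_simp
  ring

theorem scaledRadau_ne_zero {k : ℕ} {a b : ℝ} (hab : a < b) : scaledRadau k a b ≠ 0 := by
  intro h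
  simpa [h] using scaledRadau_eval_left (k := k) hab

theorem natDegree_scaledRadau_le (k : ℕ) (a b : ℝ) : (scaledRadau k a b).natDegree ≤ k + 1 := by
  refine natDegree_comp_le.trans ?_
  have h : (C (1 / (b - a)) * (2 * X - C (b + a))).natDegree ≤ 1 := by
    compute_degree
  calc _ ≤ (k + 1) * 1 := Nat.mul_le_mul (natDegree_leftRadau_le k) h
    _ = k + 1 := mul_one _

/-- On `(a, b)` the Radau polynomial of degree `k + 1` is orthogonal to all polynomials of
degree less than `k`. -/
theorem integral_scaledRadau_mul_eq_zero {k : ℕ} {a b : ℝ} (hab : a < b) {q : ℝ[X]}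
    (hq : q.degree < k) :
    ∫ s in a..b, (scaledRadau k a b).eval s * q.eval s = 0 := by
  have hba : b - a ≠ 0 := (sub_pos.2 hab).ne'
  set r : ℝ[X] := q.comp (C ((b - a) / 2) * X + C ((b + a) / 2)) with hr
  have hrd : r.degree < k := by
    by_cases h0 : q = 0
    · simp [hr, h0]
    · rw [degree_eq_natDegree h0] at hq
      have h1 : (C ((b - a) / 2) * X + C ((b + a) / 2)).natDegree ≤ 1 := natDegree_linear_le
      have h2 : r.natDegree ≤ q.natDegree :=
        natDegree_comp_le.trans ((Nat.mul_le_mul le_rfl h1).trans (mul_one _).le)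
      exact (degree_le_natDegree.trans (by exact_mod_cast h2)).trans_lt hq
  have key := intervalIntegral.integral_comp_mul_add (a := a) (b := b)
    (fun x => (leftRadau k).eval x * r.eval x) (c := 2 / (b - a))
    (by positivity) (-(b + a) / (b - a))
  have e1 : 2 / (b - a) * a + -(b + a) / (b - a) = -1 := by field_simp; ring
  have e2 : 2 / (b - a) * b + -(b + a) / (b - a) = 1 := by field_simp; ring
  rw [e1, e2, integral_leftRadau_mul_eq_zero hrd, smul_zero] at key
  rw [← key]
  refine intervalIntegral.integral_congr fun s _ => ?_
  simp only [scaledRadau_eval, hr, eval_comp, eval_add, eval_mul, eval_C, eval_X]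
  congr 2
  · field_simp; ring
  · field_simp; ring

/-- The sign changes of a polynomial `p` on `(a, b)` can be compensated by simple factors at
some of its zeros. -/
theorem exists_finset_roots_mul_nonneg (a b : ℝ) (p : ℝ[X]) (hp : p ≠ 0) :
    ∃ (Z : Finset ℝ) (c : ℝ), c ≠ 0 ∧ (∀ z ∈ Z, z ∈ Ioo a b ∧ p.eval z = 0) ∧
      ∀ s ∈ Ioo a b, 0 ≤ c * (p.eval s * ∏ z ∈ Z, (s - z)) := by
  induction hd : p.natDegree using Nat.strong_induction_on generalizing p with
  | _ d ih =>
    by_cases h : ∃ z ∈ Ioo a b, p.eval z = 0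
    · obtain ⟨z, hz, hz0⟩ := h
      obtain ⟨p₁, rfl⟩ := dvd_iff_isRoot.2 hz0
      have hp₁ : p₁ ≠ 0 := right_ne_zero_of_mul hp
      have hdeg : p₁.natDegree < d := by
        rw [← hd, natDegree_mul (X_sub_C_ne_zero z) hp₁, natDegree_X_sub_C]; omega
      obtain ⟨Z, c, hc, hZ, hs⟩ := ih _ hdeg p₁ hp₁ rfl
      by_cases hzZ : z ∈ Z
      · refine ⟨Z.erase z, c, hc, fun w hw => ?_, fun s hs' => ?_⟩
        · obtain ⟨h1, h2⟩ := hZ w (Finset.mem_of_mem_erase hw)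
          exact ⟨h1, by simp [h2]⟩
        · have := hs s hs'
          rw [← Finset.mul_prod_erase Z _ hzZ] at this
          simp only [eval_mul, eval_sub, eval_X, eval_C]
          linarith
      · refine ⟨insert z Z, c, hc, fun w hw => ?_, fun s hs' => ?_⟩
        · rcases Finset.mem_insert.1 hw with rfl | hw
          · exact ⟨hz, hz0⟩
          · obtain ⟨h1, h2⟩ := hZ w hw
            exact ⟨h1, by simp [h2]⟩
        · rw [Finset.prod_insert hzZ]
          simp only [eval_mul, eval_sub, eval_X, eval_C]
          have := mul_nonneg (sq_nonneg (s - z)) (hs s hs')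
          linarith
    · push Not at h
      rcases (Ioo a b).eq_empty_or_nonempty with he | ⟨m, hm⟩
      · exact ⟨∅, 1, one_ne_zero, by simp, by simp [he]⟩
      · -- without zeros, the polynomial keeps the sign it has at `m`
        refine ⟨∅, p.eval m, h m hm, by simp, fun s hs => ?_⟩
        by_contra! hneg
        simp only [Finset.prod_empty, mul_one] at hneg
        have hconn : IsPreconnected ((fun x => p.eval m * p.eval x) '' Ioo a b) :=
          isPreconnected_Ioo.image _ (by fun_prop)
        have h0 := hconn.Icc_subset (mem_image_of_mem _ hs) (mem_image_of_mem _ hm)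
          (show (0 : ℝ) ∈ _ from ⟨hneg.le, mul_self_nonneg _⟩)
        obtain ⟨x, hx, hx0⟩ := h0
        rcases mul_eq_zero.1 hx0 with h1 | h1
        · exact h m hm h1
        · exact h x hx h1

theorem mem_radauZeros {k : ℕ} {a b : ℝ} (hab : a < b) {z : ℝ} :
    z ∈ radauZeros k a b ↔ (scaledRadau k a b).eval z = 0 := by
  rw [radauZeros, Multiset.mem_toFinset, mem_roots (scaledRadau_ne_zero hab), IsRoot.def]

/-- The Radau polynomial has `k` zeros in the open interval (otherwise the product of linear
factors compensating its sign changes would contradict orthogonality) and one at `b`, so these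
are all of its zeros. -/
theorem card_radauZeros_and_mem {k : ℕ} {a b : ℝ} (hab : a < b) :
    (radauZeros k a b).card = k + 1 ∧ ∀ z ∈ radauZeros k a b, z ∈ Ioc a b := by
  set R := scaledRadau k a b with hR
  have hR0 : R ≠ 0 := scaledRadau_ne_zero hab
  obtain ⟨Z, c, hc, hZ, hs⟩ := exists_finset_roots_mul_nonneg a b R hR0
  have hq0 : (∏ z ∈ Z, (X - C z)) ≠ (0 : ℝ[X]) :=
    Finset.prod_ne_zero_iff.2 fun z _ => X_sub_C_ne_zero z
  have hkZ : k ≤ Z.card := by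
    by_contra! hlt
    have hdeg : (∏ z ∈ Z, (X - C z) : ℝ[X]).degree < k := by
      rw [degree_prod]
      simpa using hlt
    have horth := integral_scaledRadau_mul_eq_zero hab hdeg
    have hzero : C c * (R * ∏ z ∈ Z, (X - C z)) = 0 := by
      refine eq_zero_of_integral_eq_zero hab (fun s hs' => ?_) ?_
      · simpa [eval_prod] using hs s hs'
      · simp only [eval_mul, eval_C]
        rw [intervalIntegral.integral_const_mul, horth, mul_zero]
    exact (mul_ne_zero (C_ne_zero.2 hc) (mul_ne_zero hR0 hq0)) hzero
  have hbZ : b ∉ Z := fun h => lt_irrefl b (hZ b h).1.2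
  have hsub : insert b Z ⊆ radauZeros k a b := by
    intro z hz
    rw [mem_radauZeros hab]
    rcases Finset.mem_insert.1 hz with rfl | hz
    · exact scaledRadau_eval_right hab
    · exact (hZ z hz).2
  have hcard : (radauZeros k a b).card ≤ k + 1 :=
    (Multiset.toFinset_card_le _).trans ((card_roots' _).trans (natDegree_scaledRadau_le k a b))
  have hle : (radauZeros k a b).card ≤ (insert b Z).card := by
    rw [Finset.card_insert_of_notMem hbZ]; omega
  have heq := Finset.eq_of_subset_of_card_le hsub hle
  refine ⟨le_antisymm hcard ?_, fun z hz => ?_⟩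
  · rw [← heq, Finset.card_insert_of_notMem hbZ]; omega
  · rw [← heq] at hz
    rcases Finset.mem_insert.1 hz with rfl | hz
    · exact ⟨hab, le_rfl⟩
    · exact Ioo_subset_Ioc_self (hZ z hz).1

theorem natDegree_scaledRadau {k : ℕ} {a b : ℝ} (hab : a < b) :
    (scaledRadau k a b).natDegree = k + 1 := by
  refine le_antisymm (natDegree_scaledRadau_le k a b) ?_
  rw [← (card_radauZeros_and_mem (k := k) hab).1]
  exact (Multiset.toFinset_card_le _).trans (card_roots' _)

theorem radauZeros_subset_Icc {k : ℕ} {a b : ℝ} (hab : a < b) {z : ℝ}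
    (hz : z ∈ radauZeros k a b) : z ∈ Icc a b :=
  Ioc_subset_Icc_self ((card_radauZeros_and_mem hab).2 z hz)

/-! ### Interpolation at the Radau zeros -/

theorem natDegree_radauInterp_le {k : ℕ} {a b : ℝ} (hab : a < b) (g : ℝ → ℝ) :
    (radauInterp k a b g).natDegree ≤ k := by
  have h := Lagrange.degree_interpolate_le (s := radauZeros k a b) (v := id) g
    (injOn_id _)
  rw [(card_radauZeros_and_mem hab).1, Nat.add_sub_cancel] at h
  exact natDegree_le_iff_degree_le.2 h

theorem radauInterp_congr {k : ℕ} {a b : ℝ} {g g' : ℝ → ℝ}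
    (h : ∀ z ∈ radauZeros k a b, g z = g' z) : radauInterp k a b g = radauInterp k a b g' :=
  Lagrange.interpolate_eq_of_values_eq_on g g' h

theorem radauInterp_sub (k : ℕ) (a b : ℝ) (g g' : ℝ → ℝ) :
    radauInterp k a b (g - g') = radauInterp k a b g - radauInterp k a b g' :=
  map_sub _ g g'

theorem eval_radauInterp_of_mem {k : ℕ} {a b : ℝ} (g : ℝ → ℝ) {z : ℝ}
    (hz : z ∈ radauZeros k a b) : (radauInterp k a b g).eval z = g z :=
  Lagrange.eval_interpolate_at_node (v := id) g (injOn_id _) hz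

theorem eq_radauInterp {k : ℕ} {a b : ℝ} (hab : a < b) {p : ℝ[X]} (hp : p.natDegree ≤ k)
    {g : ℝ → ℝ} (h : ∀ z ∈ radauZeros k a b, p.eval z = g z) : p = radauInterp k a b g := by
  refine Lagrange.eq_interpolate_of_eval_eq g (injOn_id _) ?_ h
  rw [(card_radauZeros_and_mem hab).1]
  exact (natDegree_le_iff_degree_le.1 hp).trans_lt (by exact_mod_cast k.lt_succ_self)

theorem scaledRadau_eval_of_mem {k : ℕ} {a b : ℝ} (hab : a < b) {z : ℝ}
    (hz : z ∈ radauZeros k a b) : (scaledRadau k a b).eval z = 0 :=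
  (mem_radauZeros hab).1 hz

/-- A multiple of the Radau polynomial removes the term of degree `k + 1`. -/
theorem exists_natDegree_sub_scaledRadau_le {k : ℕ} {a b : ℝ} (hab : a < b) {p : ℝ[X]}
    (hp : p.natDegree ≤ k + 1) : ∃ c : ℝ, (p - C c * scaledRadau k a b).natDegree ≤ k := by
  have hlead : (scaledRadau k a b).coeff (k + 1) ≠ 0 := by
    rw [← natDegree_scaledRadau hab]
    exact leadingCoeff_ne_zero.2 (scaledRadau_ne_zero hab)
  refine ⟨p.coeff (k + 1) / (scaledRadau k a b).coeff (k + 1), ?_⟩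
  rw [natDegree_le_iff_coeff_eq_zero]
  intro m hm
  rcases (Nat.succ_le_of_lt hm).lt_or_eq with h | h
  · have h1 : p.coeff m = 0 := coeff_eq_zero_of_natDegree_lt (by omega)
    have h2 : (scaledRadau k a b).coeff m = 0 :=
      coeff_eq_zero_of_natDegree_lt (by rw [natDegree_scaledRadau hab]; omega)
    simp [h1, h2]
  · subst h
    simp [hlead]

/-! ### The Galerkin methods as collocation methods -/

theorem degree_derivative_lt_of_natDegree_le {k : ℕ} {v : ℝ[X]} (hv : v.natDegree ≤ k) :
    (derivative v).degree < k := by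
  by_cases h0 : v = 0
  · simp [h0]
  · exact (degree_derivative_lt h0).trans_le (natDegree_le_iff_degree_le.1 hv)

/-- `W` solves, on the interval `(a, b)` with initial value `α` at `a`, the collocation method
of degree `k + 1` at the Radau zeros: `W' = I_R g(·, W(·))` as polynomials. -/
structure IsCollocation (k : ℕ) (a b α : ℝ) (g : ℝ → ℝ → ℝ) (W : ℝ[X]) : Prop where
  natDegree_le : W.natDegree ≤ k + 1
  derivative_eq : derivative W = radauInterp k a b fun r => g r (W.eval r)
  eval_left : W.eval a = α

/-- Both sides of the weak form of the CG method are `L²` products with polynomials of degree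
at most `k`, hence it says that `W'` is the interpolant of the right-hand side. -/
theorem isCGSolution_iff {k N : ℕ} {T u₀ : ℝ} {t : Fin (N + 1) → ℝ} (ht : IsPartition T t)
    {f : ℝ → ℝ → ℝ} {W : Fin N → ℝ[X]} :
    IsCGSolution k t u₀ f W ↔ ∀ n,
      IsCollocation k (t n.castSucc) (t n.succ) (leftTrace t u₀ W n.castSucc) f (W n) := by
  constructor
  · intro h n
    have hab := ht.strictMono n.castSucc_lt_succ
    refine ⟨h.natDegree_le n, ?_, h.continuous_at_nodes n⟩
    set I := radauInterp k (t n.castSucc) (t n.succ) fun r => f r ((W n).eval r)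
    set p := derivative (W n) - I with hp
    have hpd : p.natDegree ≤ k :=
      (natDegree_sub_le _ _).trans (max_le ((natDegree_derivative_le _).trans
        (Nat.sub_le_of_le_add (h.natDegree_le n))) (natDegree_radauInterp_le hab _))
    have hw := h.weak n p hpd
    have hp2 : p * p = 0 := by
      refine eq_zero_of_integral_eq_zero hab (fun s _ => by simp [mul_self_nonneg]) ?_
      calc _ = ∫ s in (t n.castSucc)..(t n.succ),
            (p.eval s * (derivative (W n)).eval s - I.eval s * p.eval s) := by
            refine intervalIntegral.integral_congr fun s _ => ?_
            simp only [hp, eval_mul, eval_sub]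
            ring
        _ = 0 := by
            rw [intervalIntegral.integral_sub, hw, sub_self]
            · exact Continuous.intervalIntegrable (by fun_prop) _ _
            · exact Continuous.intervalIntegrable (by fun_prop) _ _
    exact sub_eq_zero.1 (mul_self_eq_zero.1 hp2)
  · intro h
    refine ⟨fun n => (h n).natDegree_le, fun n v _ => ?_, fun n => (h n).eval_left⟩
    rw [(h n).derivative_eq]
    exact intervalIntegral.integral_congr fun s _ => mul_comm _ _

theorem postProcess_eval_of_mem {k N : ℕ} {T u₀ : ℝ} {t : Fin (N + 1) → ℝ}
    (ht : IsPartition T t) (U : Fin N → ℝ[X]) (n : Fin N) {z : ℝ}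
    (hz : z ∈ radauZeros k (t n.castSucc) (t n.succ)) :
    (postProcess k t u₀ U n).eval z = (U n).eval z := by
  simp [postProcess, scaledRadau_eval_of_mem (ht.strictMono n.castSucc_lt_succ) hz]

theorem leftTrace_congr {N : ℕ} {t : Fin (N + 1) → ℝ} {u₀ : ℝ} {U V : Fin N → ℝ[X]}
    (h : ∀ n, (U n).eval (t n.succ) = (V n).eval (t n.succ)) :
    leftTrace t u₀ U = leftTrace t u₀ V := by
  funext m
  refine Fin.cases rfl (fun n => ?_) m
  exact h n

theorem leftTrace_postProcess {k N : ℕ} {T u₀ : ℝ} {t : Fin (N + 1) → ℝ}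
    (ht : IsPartition T t) (U : Fin N → ℝ[X]) :
    leftTrace t u₀ (postProcess k t u₀ U) = leftTrace t u₀ U := by
  refine leftTrace_congr fun n => ?_
  simp [postProcess, scaledRadau_eval_right (ht.strictMono n.castSucc_lt_succ)]

theorem postProcess_eval_left {k N : ℕ} {T u₀ : ℝ} {t : Fin (N + 1) → ℝ}
    (ht : IsPartition T t) (U : Fin N → ℝ[X]) (n : Fin N) :
    (postProcess k t u₀ U n).eval (t n.castSucc) = leftTrace t u₀ U n.castSucc := by
  simp [postProcess, scaledRadau_eval_left (ht.strictMono n.castSucc_lt_succ)]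

/-- Adding `c R`, where `R` is the Radau polynomial and `c` the jump at the left end, turns the
DG bilinear form into `∫ v W'`: `R` is orthogonal to `v'`. -/
theorem integral_mul_derivative_postProcess {k N : ℕ} {T u₀ : ℝ} {t : Fin (N + 1) → ℝ}
    (ht : IsPartition T t) (U : Fin N → ℝ[X]) (n : Fin N) {v : ℝ[X]} (hv : v.natDegree ≤ k) :
    ∫ s in (t n.castSucc)..(t n.succ),
        v.eval s * (derivative (postProcess k t u₀ U n)).eval s =
      -(∫ s in (t n.castSucc)..(t n.succ), (U n).eval s * (derivative v).eval s)
        + (leftTrace t u₀ U n.succ * v.eval (t n.succ)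
            - leftTrace t u₀ U n.castSucc * v.eval (t n.castSucc)) := by
  have hab := ht.strictMono n.castSucc_lt_succ
  have hcomm : ∀ s, v.eval s * (derivative (postProcess k t u₀ U n)).eval s =
      (derivative (postProcess k t u₀ U n)).eval s * v.eval s := fun s => mul_comm _ _
  simp only [hcomm]
  rw [integral_eval_derivative_mul, postProcess_eval_left ht]
  have hr : (postProcess k t u₀ U n).eval (t n.succ) = leftTrace t u₀ U n.succ := by
    simp [postProcess, scaledRadau_eval_right hab, leftTrace]
  have hint : ∫ s in (t n.castSucc)..(t n.succ),
      (postProcess k t u₀ U n).eval s * (derivative v).eval s =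
      ∫ s in (t n.castSucc)..(t n.succ), (U n).eval s * (derivative v).eval s := by
    simp only [postProcess, eval_add, eval_mul, eval_C, add_mul, mul_assoc]
    rw [intervalIntegral.integral_add, intervalIntegral.integral_const_mul,
      integral_scaledRadau_mul_eq_zero hab (degree_derivative_lt_of_natDegree_le hv),
      mul_zero, add_zero]
    · exact Continuous.intervalIntegrable (by fun_prop) _ _
    · exact Continuous.intervalIntegrable (by fun_prop) _ _
  rw [hr, hint]
  ring

/-- Post-processing turns the DG method into the CG method. -/
theorem isDGSolution_iff {k N : ℕ} {T u₀ : ℝ} {t : Fin (N + 1) → ℝ} (ht : IsPartition T t)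
    {f : ℝ → ℝ → ℝ} {U : Fin N → ℝ[X]} (hU : ∀ n, (U n).natDegree ≤ k) :
    IsDGSolution k t u₀ f U ↔ IsCGSolution k t u₀ f (postProcess k t u₀ U) := by
  have hI : ∀ n, (radauInterp k (t n.castSucc) (t n.succ) fun r =>
        f r ((postProcess k t u₀ U n).eval r)) =
      radauInterp k (t n.castSucc) (t n.succ) fun r => f r ((U n).eval r) := fun n =>
    radauInterp_congr fun z hz => by rw [postProcess_eval_of_mem ht U n hz]
  constructor
  · intro h
    refine ⟨fun n => ?_, fun n v hv => ?_, fun n => ?_⟩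
    · exact natDegree_add_le_of_degree_le ((hU n).trans k.le_succ)
        ((natDegree_C_mul_le _ _).trans (natDegree_scaledRadau_le _ _ _))
    · rw [integral_mul_derivative_postProcess ht U n hv, hI]
      exact h.weak n v hv
    · rw [leftTrace_postProcess ht, postProcess_eval_left ht]
  · intro h
    refine ⟨hU, fun n v hv => ?_⟩
    rw [← integral_mul_derivative_postProcess ht U n hv, ← hI]
    exact h.weak n v hv

theorem bijOn_postProcess {k N : ℕ} {T u₀ : ℝ} {t : Fin (N + 1) → ℝ} (ht : IsPartition T t)
    {f : ℝ → ℝ → ℝ} :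
    BijOn (postProcess k t u₀) {U | IsDGSolution k t u₀ f U} {W | IsCGSolution k t u₀ f W} := by
  refine ⟨fun U hU => (isDGSolution_iff ht hU.natDegree_le).1 hU, fun U hU V hV h => ?_,
    fun W hW => ?_⟩
  · funext n
    have hab := ht.strictMono n.castSucc_lt_succ
    -- the difference has degree at most `k` and vanishes at the `k + 1` Radau zeros
    rw [eq_radauInterp hab (hU.natDegree_le n) (fun _ _ => rfl),
      eq_radauInterp hab (hV.natDegree_le n) (fun _ _ => rfl)]
    refine radauInterp_congr fun z hz => ?_
    rw [← postProcess_eval_of_mem (u₀ := u₀) ht U n hz, h, postProcess_eval_of_mem ht V n hz]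
  · have hex := fun n : Fin N => exists_natDegree_sub_scaledRadau_le
      (ht.strictMono n.castSucc_lt_succ) (hW.natDegree_le n)
    choose c hc using hex
    set U : Fin N → ℝ[X] := fun n =>
      W n - C (c n) * scaledRadau k (t n.castSucc) (t n.succ) with hUdef
    have htr : leftTrace t u₀ U = leftTrace t u₀ W := leftTrace_congr fun n => by
      simp [hUdef, scaledRadau_eval_right (ht.strictMono n.castSucc_lt_succ)]
    have hpost : postProcess k t u₀ U = W := by
      funext n
      rw [postProcess, htr, ← hW.continuous_at_nodes n]
      simp [hUdef, scaledRadau_eval_left (ht.strictMono n.castSucc_lt_succ)]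
    refine ⟨U, ?_, hpost⟩
    refine (isDGSolution_iff ht hc).2 ?_
    rw [hpost]
    exact hW

/-! ### The Lebesgue constant -/

/-- `Λ` bounds the Lebesgue constant of interpolation at the `k + 1` Radau zeros, uniformly
over all intervals. -/
def IsLebesgueBound (k : ℕ) (Λ : ℝ) : Prop :=
  ∀ ⦃a b : ℝ⦄, a < b → ∀ (g : ℝ → ℝ) (M : ℝ), (∀ z ∈ radauZeros k a b, |g z| ≤ M) →
    ∀ s ∈ Icc a b, |(radauInterp k a b g).eval s| ≤ Λ * M

theorem radauZeros_nonempty {k : ℕ} {a b : ℝ} (hab : a < b) : (radauZeros k a b).Nonempty := by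
  rw [← Finset.card_pos, (card_radauZeros_and_mem hab).1]
  exact k.succ_pos

theorem exists_isLebesgueBound (k : ℕ) : ∃ Λ : ℝ, 0 ≤ Λ ∧ IsLebesgueBound k Λ := by
  set Z := radauZeros k (-1) 1
  obtain ⟨Λ, hΛ⟩ := isCompact_Icc.exists_bound_of_continuousOn (s := Icc (-1 : ℝ) 1)
    (f := fun x => ∑ ζ ∈ Z, |(Lagrange.basis Z id ζ).eval x|)
    (Continuous.continuousOn (by fun_prop))
  have hΛ0 : 0 ≤ Λ := (norm_nonneg _).trans (hΛ 0 (by norm_num))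
  refine ⟨Λ, hΛ0, fun a b hab g M hM s hs => ?_⟩
  have hba : 0 < b - a := sub_pos.2 hab
  set m : ℝ[X] := C ((b - a) / 2) * X + C ((b + a) / 2) with hm
  have hm1 : m.natDegree ≤ 1 := natDegree_linear_le
  have hmZ : ∀ ζ ∈ Z, m.eval ζ ∈ radauZeros k a b := fun ζ hζ => by
    rw [mem_radauZeros hab, scaledRadau_eval]
    rw [mem_radauZeros (by norm_num), scaledRadau_eval] at hζ
    convert hζ using 2
    simp [hm]
    field_simp
    ring
  -- pull the interpolant back to `[-1, 1]`
  have hcomp : (radauInterp k a b g).comp m = radauInterp k (-1) 1 fun x => g (m.eval x) := by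
    refine eq_radauInterp (by norm_num) ?_ fun ζ hζ => ?_
    · exact natDegree_comp_le.trans
        ((Nat.mul_le_mul (natDegree_radauInterp_le hab g) hm1).trans (mul_one _).le)
    · rw [eval_comp, eval_radauInterp_of_mem g (hmZ ζ hζ)]
  set x := (2 * s - (b + a)) / (b - a) with hx
  have hxs : m.eval x = s := by
    simp [hm, hx]
    field_simp
    ring
  have hx1 : x ∈ Icc (-1 : ℝ) 1 := by
    constructor
    · rw [hx, le_div_iff₀ hba]; linarith [hs.1]
    · rw [hx, div_le_iff₀ hba]; linarith [hs.2]
  rw [← hxs, ← eval_comp, hcomp, radauInterp, Lagrange.interpolate_apply, eval_finsetSum]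
  have hM0 : 0 ≤ M := by
    obtain ⟨z, hz⟩ := radauZeros_nonempty (k := k) hab
    exact (abs_nonneg _).trans (hM z hz)
  calc _ ≤ ∑ ζ ∈ Z, |(C (g (m.eval ζ)) * Lagrange.basis Z id ζ).eval x| :=
        Finset.abs_sum_le_sum_abs _ _
    _ ≤ ∑ ζ ∈ Z, M * |(Lagrange.basis Z id ζ).eval x| := by
        refine Finset.sum_le_sum fun ζ hζ => ?_
        rw [eval_mul, eval_C, abs_mul]
        exact mul_le_mul_of_nonneg_right (hM _ (hmZ ζ hζ)) (abs_nonneg _)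
    _ = (∑ ζ ∈ Z, |(Lagrange.basis Z id ζ).eval x|) * M := by
        rw [← Finset.mul_sum, mul_comm]
    _ ≤ Λ * M := mul_le_mul_of_nonneg_right ((le_abs_self _).trans (hΛ x hx1)) hM0

/-! ### Solvability of the collocation equations -/

theorem exists_derivative_eq (p : ℝ[X]) (a α : ℝ) :
    ∃ W : ℝ[X], derivative W = p ∧ W.eval a = α ∧ W.natDegree ≤ p.natDegree + 1 := by
  set V : ℝ[X] := ∑ i ∈ Finset.range (p.natDegree + 1),
    C (p.coeff i / (i + 1)) * X ^ (i + 1) with hV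
  have hVd : derivative V = p := by
    conv_rhs => rw [p.as_sum_range_C_mul_X_pow]
    rw [hV, derivative_sum]
    refine Finset.sum_congr rfl fun i _ => ?_
    have : (i : ℝ) + 1 ≠ 0 := by positivity
    rw [derivative_C_mul_X_pow]
    simp [this]
  have hVn : V.natDegree ≤ p.natDegree + 1 :=
    natDegree_sum_le_of_forall_le _ _ fun i hi =>
      (natDegree_C_mul_X_pow_le _ _).trans (by simpa using hi)
  refine ⟨V + C (α - V.eval a), by simp [hVd], by simp, ?_⟩
  exact natDegree_add_le_of_degree_le hVn (by simp)

theorem eq_of_derivative_eq {V W : ℝ[X]} {a : ℝ} (h : derivative V = derivative W)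
    (ha : V.eval a = W.eval a) : V = W := by
  have h0 : derivative (V - W) = 0 := by simp [h]
  have h1 := eq_C_of_derivative_eq_zero h0
  have h2 : (V - W).eval a = 0 := by simp [ha]
  rw [h1, eval_C] at h2
  rw [h2, C_0] at h1
  exact sub_eq_zero.1 h1

theorem abs_sub_le_of_hasDerivWithinAt {e e' : ℝ → ℝ} {a b C : ℝ}
    (he : ∀ s ∈ Icc a b, HasDerivWithinAt e (e' s) (Icc a b) s)
    (hC : ∀ s ∈ Icc a b, |e' s| ≤ C) (hC0 : 0 ≤ C) {s : ℝ} (hs : s ∈ Icc a b) :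
    |e s - e a| ≤ (b - a) * C := by
  have h := (convex_Icc a b).norm_image_sub_le_of_norm_hasDerivWithin_le he hC
    (left_mem_Icc.2 (hs.1.trans hs.2)) hs
  rw [Real.norm_eq_abs, Real.norm_eq_abs, abs_of_nonneg (sub_nonneg.2 hs.1)] at h
  rw [mul_comm]
  exact h.trans (mul_le_mul_of_nonneg_left (by linarith [hs.2]) hC0)

/-- Absorption: if the maximum `M` of `|y|` over a finite set satisfies `M ≤ A + M / 2`, then
`M ≤ 2 A`. -/
theorem abs_le_two_mul_of_forall_le {Z : Finset ℝ} {y : ℝ → ℝ} {A : ℝ}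
    (h : ∀ M, 0 ≤ M → (∀ z ∈ Z, |y z| ≤ M) → ∀ z ∈ Z, |y z| ≤ A + M / 2) :
    ∀ z ∈ Z, |y z| ≤ 2 * A := by
  intro z hz
  obtain ⟨w, hw, hmax⟩ := Z.exists_max_image (fun x => |y x|) ⟨z, hz⟩
  have := h |y w| (abs_nonneg _) hmax w hw
  linarith [hmax z hz]

theorem abs_sub_le_of_lipschitzWith {L : ℝ≥0} {g : ℝ → ℝ} (hg : LipschitzWith L g) (x y : ℝ) :
    |g x - g y| ≤ L * |x - y| := by
  simpa [Real.dist_eq] using hg.dist_le_mul x y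

/-- On short intervals the collocation equations are a fixed-point problem for a contraction on
the space of values at the Radau zeros. -/
theorem existsUnique_isCollocation {k : ℕ} {Λ : ℝ} (hΛ : IsLebesgueBound k Λ) (hΛ0 : 0 ≤ Λ)
    {L : ℝ≥0} {a b : ℝ} (hab : a < b) (hsmall : (b - a) * (Λ * L) ≤ 1 / 2) {g : ℝ → ℝ → ℝ}
    (hg : ∀ s ∈ Icc a b, LipschitzWith L (g s)) (α : ℝ) :
    ∃! W : ℝ[X], IsCollocation k a b α g W := by
  set Z := radauZeros k a b with hZ
  -- two polynomials with derivatives interpolating nearby data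
  have hdiff : ∀ {V W : ℝ[X]} {y y' : ℝ → ℝ} {M : ℝ}, 0 ≤ M →
      derivative V = radauInterp k a b y → derivative W = radauInterp k a b y' →
      V.eval a = W.eval a → (∀ z ∈ Z, |y z - y' z| ≤ L * M) →
      ∀ z ∈ Icc a b, |V.eval z - W.eval z| ≤ 1 / 2 * M := by
    intro V W y y' M hM hV hW hVW hy z hz
    have h1 := abs_sub_le_of_hasDerivWithinAt (e := fun s => (V - W).eval s)
      (e' := fun s => (derivative (V - W)).eval s) (C := Λ * (L * M))
      (fun s _ => (V - W).hasDerivWithinAt s _) (fun s hs => ?_) (by positivity) hz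
    · simp only [eval_sub, hVW, sub_self, sub_zero] at h1
      calc _ ≤ _ := h1
        _ = (b - a) * (Λ * L) * M := by ring
        _ ≤ 1 / 2 * M := mul_le_mul_of_nonneg_right hsmall hM
    · rw [derivative_sub, hV, hW, ← radauInterp_sub]
      exact hΛ hab _ _ hy s hs
  have hex : ∃ W : ℝ[X], IsCollocation k a b α g W := by
    classical
    let ext : (Z → ℝ) → ℝ → ℝ := fun w r => if h : r ∈ Z then g r (w ⟨r, h⟩) else 0
    have hpr := fun w : Z → ℝ => exists_derivative_eq (radauInterp k a b (ext w)) a α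
    choose P hP hPa hPd using hpr
    let Φ : (Z → ℝ) → (Z → ℝ) := fun w z => (P w).eval z
    have hΦ : ContractingWith (1 / 2 : ℝ≥0) Φ := by
      refine ⟨by rw [← NNReal.coe_lt_coe]; norm_num,
        LipschitzWith.of_dist_le_mul fun w w' => ?_⟩
      rw [dist_pi_le_iff (by positivity)]
      intro z
      rw [Real.dist_eq]
      have := hdiff (dist_nonneg (x := w) (y := w')) (hP w) (hP w') (by rw [hPa, hPa])
        (fun r hr => ?_) z (radauZeros_subset_Icc hab z.2)
      · simpa using this
      · simp only [ext, hr, dif_pos]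
        refine (abs_sub_le_of_lipschitzWith (hg r (radauZeros_subset_Icc hab hr)) _ _).trans ?_
        rw [← Real.dist_eq]
        exact mul_le_mul_of_nonneg_left (dist_le_pi_dist w w' _) L.2
    obtain ⟨w, hw⟩ : ∃ w, Φ w = w := ⟨_, hΦ.fixedPoint_isFixedPt⟩
    refine ⟨P w, (hPd _).trans ?_, ?_, hPa _⟩
    · exact Nat.succ_le_succ (natDegree_radauInterp_le hab _)
    · rw [hP]
      refine radauInterp_congr fun z hz => ?_
      have hz' : z ∈ Z := hz
      have h2 : (P w).eval z = w ⟨z, hz'⟩ := congrFun hw ⟨z, hz'⟩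
      simp only [ext, hz', dif_pos, h2]
  obtain ⟨W, hW⟩ := hex
  refine ⟨W, hW, fun V hV => ?_⟩
  have hVW : V.eval a = W.eval a := by rw [hV.eval_left, hW.eval_left]
  have h0 : ∀ z ∈ Z, |V.eval z - W.eval z| ≤ 2 * 0 := by
    refine abs_le_two_mul_of_forall_le (y := fun z => V.eval z - W.eval z)
      fun M hM0 hM z hz => ?_
    have := hdiff hM0 hV.derivative_eq hW.derivative_eq hVW (fun r hr => ?_) z
      (radauZeros_subset_Icc hab hz)
    · linarith
    · exact (abs_sub_le_of_lipschitzWith (hg r (radauZeros_subset_Icc hab hr)) _ _).trans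
        (mul_le_mul_of_nonneg_left (hM r hr) L.2)
  refine eq_of_derivative_eq ?_ hVW
  rw [hV.derivative_eq, hW.derivative_eq]
  refine radauInterp_congr fun z hz => ?_
  have : V.eval z = W.eval z := by
    have := h0 z hz
    rw [mul_zero] at this
    exact sub_eq_zero.1 (abs_nonpos_iff.1 this)
  rw [this]

/-! ### Consistency -/

/-- Taylor approximation on all subintervals with one constant. -/
theorem exists_polynomial_approx {T : ℝ} (hT : 0 < T) {w : ℝ → ℝ} (m : ℕ)
    (hw : ContDiffOn ℝ ((m + 1 : ℕ) : WithTop ℕ∞) w (Icc 0 T)) :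
    ∃ M : ℝ, 0 ≤ M ∧ ∀ a b : ℝ, a < b → Icc a b ⊆ Icc 0 T →
      ∃ p : ℝ[X], p.natDegree ≤ m ∧ ∀ s ∈ Icc a b, |w s - p.eval s| ≤ M * (b - a) ^ (m + 1) := by
  obtain ⟨M, hM⟩ := isCompact_Icc.exists_bound_of_continuousOn
    (hw.continuousOn_iteratedDerivWithin le_rfl (uniqueDiffOn_Icc hT))
  have hM0 : 0 ≤ M := (norm_nonneg _).trans (hM 0 ⟨le_rfl, hT.le⟩)
  refine ⟨M, hM0, fun a b hab hsub => ?_⟩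
  refine ⟨∑ i ∈ Finset.range (m + 1),
    C ((i.factorial : ℝ)⁻¹ * iteratedDerivWithin i w (Icc a b) a) * (X - C a) ^ i, ?_, ?_⟩
  · refine natDegree_sum_le_of_forall_le _ _ fun i hi => ?_
    refine (natDegree_C_mul_le _ _).trans ?_
    rw [natDegree_pow, natDegree_X_sub_C, mul_one]
    exact Nat.lt_succ_iff.1 (Finset.mem_range.1 hi)
  · intro s hs
    have hbound := taylor_mean_remainder_bound (n := m) (C := M) hab.le
      (by exact_mod_cast hw.mono hsub) hs fun y hy => by
        rw [iteratedDerivWithin_eq_iteratedFDerivWithin,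
          iteratedFDerivWithin_subset hsub (uniqueDiffOn_Icc hab) (uniqueDiffOn_Icc hT) hw hy,
          ← iteratedDerivWithin_eq_iteratedFDerivWithin]
        exact hM y (hsub hy)
    have heq : taylorWithinEval w m (Icc a b) a s =
        (∑ i ∈ Finset.range (m + 1),
          C ((i.factorial : ℝ)⁻¹ * iteratedDerivWithin i w (Icc a b) a)
            * (X - C a) ^ i : ℝ[X]).eval s := by
      rw [taylor_within_apply, eval_finsetSum]
      refine Finset.sum_congr rfl fun i _ => ?_
      simp
      ring
    rw [heq, Real.norm_eq_abs] at hbound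
    refine hbound.trans ((div_le_self ?_ ?_).trans ?_)
    · exact mul_nonneg hM0 (pow_nonneg (sub_nonneg.2 hs.1) _)
    · exact_mod_cast Nat.succ_le_of_lt m.factorial_pos
    · exact mul_le_mul_of_nonneg_left
        (pow_le_pow_left₀ (sub_nonneg.2 hs.1) (by linarith [hs.2]) _) hM0

/-- The interpolation errors of a function and of an approximating polynomial differ by at most
`Λ + 1` times the approximation error. -/
theorem abs_radauInterp_sub_sub_le {k : ℕ} {Λ : ℝ} (hΛ : IsLebesgueBound k Λ) {a b : ℝ}
    (hab : a < b) {w : ℝ → ℝ} {p : ℝ[X]} {M : ℝ} (h : ∀ s ∈ Icc a b, |w s - p.eval s| ≤ M)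
    {s : ℝ} (hs : s ∈ Icc a b) :
    |(radauInterp k a b w).eval s - w s
      - ((radauInterp k a b fun r => p.eval r).eval s - p.eval s)| ≤ (Λ + 1) * M := by
  have h1 := hΛ hab (w - fun r => p.eval r) M
    (fun z hz => h z (radauZeros_subset_Icc hab hz)) s hs
  rw [radauInterp_sub, eval_sub] at h1
  have h2 := h s hs
  rw [abs_le] at *
  constructor <;> linarith [h1.1, h1.2, h2.1, h2.2]

/-- The order of convergence at the nodes that is used: the step error of the Radau quadrature is
`O(h ^ (nodeOrder k + 1))` for integrands with `k + 2` continuous derivatives. -/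
def nodeOrder (k : ℕ) : ℕ := if k = 0 then 1 else k + 2

theorem integral_scaledRadau_eq_zero {k : ℕ} (hk : 0 < k) {a b : ℝ} (hab : a < b) :
    ∫ s in a..b, (scaledRadau k a b).eval s = 0 := by
  have := integral_scaledRadau_mul_eq_zero (k := k) hab (q := 1)
    (by rw [degree_one]; exact_mod_cast hk)
  simpa using this

/-- The interpolation error of `w` at the Radau zeros is `O(h ^ (k + 1))`. For `k > 0` its main
part is a multiple of the Radau polynomial, which has mean value zero; so up to the derivative
`Q'` of a polynomial with `Q a = Q b` it is smaller by a factor of `h`. -/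
theorem exists_interpolation_bound {k : ℕ} {Λ : ℝ} (hΛ : IsLebesgueBound k Λ) (hΛ0 : 0 ≤ Λ)
    {T : ℝ} (hT : 0 < T) {w : ℝ → ℝ}
    (hw : ContDiffOn ℝ ((k + 2 : ℕ) : WithTop ℕ∞) w (Icc 0 T)) :
    ∃ D : ℝ, 0 ≤ D ∧ ∀ a b : ℝ, a < b → Icc a b ⊆ Icc 0 T →
      (∀ s ∈ Icc a b, |(radauInterp k a b w).eval s - w s| ≤ D * (b - a) ^ (k + 1)) ∧
      ∃ Q : ℝ[X], Q.eval b = Q.eval a ∧ ∀ s ∈ Icc a b,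
        |(radauInterp k a b w).eval s - w s - (derivative Q).eval s|
          ≤ D * (b - a) ^ nodeOrder k := by
  obtain ⟨C₁, hC₁, h₁⟩ := exists_polynomial_approx hT k
    (hw.of_le (by exact_mod_cast (k + 1).le_succ))
  obtain ⟨C₂, hC₂, h₂⟩ := exists_polynomial_approx hT (k + 1) hw
  refine ⟨(Λ + 1) * (C₁ + C₂), by positivity, fun a b hab hsub => ?_⟩
  have hba : 0 ≤ b - a := sub_nonneg.2 hab.le
  have hmain : ∀ s ∈ Icc a b,
      |(radauInterp k a b w).eval s - w s| ≤ (Λ + 1) * (C₁ + C₂) * (b - a) ^ (k + 1) := by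
    intro s hs
    obtain ⟨p, hp, hps⟩ := h₁ a b hab hsub
    have h := abs_radauInterp_sub_sub_le hΛ hab hps hs
    rw [← eq_radauInterp hab hp fun _ _ => rfl, sub_self, sub_zero] at h
    refine h.trans ?_
    rw [mul_assoc]
    gcongr
    linarith
  refine ⟨hmain, ?_⟩
  rcases Nat.eq_zero_or_pos k with rfl | hk
  · exact ⟨0, by simp, by simpa [nodeOrder] using hmain⟩
  · obtain ⟨p, hp, hps⟩ := h₂ a b hab hsub
    obtain ⟨c, hc⟩ := exists_natDegree_sub_scaledRadau_le hab hp
    have hI : p - C c * scaledRadau k a b = radauInterp k a b fun r => p.eval r :=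
      eq_radauInterp hab hc fun z hz => by simp [scaledRadau_eval_of_mem hab hz]
    obtain ⟨Q, hQ, -, -⟩ := exists_derivative_eq (C (-c) * scaledRadau k a b) a 0
    refine ⟨Q, ?_, fun s hs => ?_⟩
    · have h := integral_eval_derivative Q a b
      simp only [hQ, eval_mul, eval_C] at h
      rw [intervalIntegral.integral_const_mul, integral_scaledRadau_eq_zero hk hab, mul_zero] at h
      linarith
    · have h := abs_radauInterp_sub_sub_le hΛ hab hps hs
      rw [← hI] at h
      have h3 : (derivative Q).eval s = (p - C c * scaledRadau k a b).eval s - p.eval s := by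
        rw [hQ]; simp
      rw [h3]
      refine h.trans ?_
      rw [nodeOrder, if_neg hk.ne', mul_assoc]
      gcongr
      linarith

/-! ### Error of one step -/

/-- Stability and consistency on one interval: an error bound on the whole interval, and a sharper
one at the right end, where the part `Q'` of the interpolation error does not contribute. -/
theorem abs_eval_sub_le {k : ℕ} {Λ : ℝ} (hΛ : IsLebesgueBound k Λ) (hΛ0 : 0 ≤ Λ) {L : ℝ≥0}
    {a b : ℝ} (hab : a < b) (hsmall : (b - a) * (Λ * L) ≤ 1 / 2) {g : ℝ → ℝ → ℝ}
    (hg : ∀ s ∈ Icc a b, LipschitzWith L (g s)) {u : ℝ → ℝ}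
    (hu : ∀ s ∈ Icc a b, HasDerivWithinAt u (g s (u s)) (Icc a b) s) {α : ℝ} {W : ℝ[X]}
    (hW : IsCollocation k a b α g W) {D₁ D₂ : ℝ} (hD₁ : 0 ≤ D₁) (hD₂ : 0 ≤ D₂)
    (h₁ : ∀ s ∈ Icc a b, |(radauInterp k a b fun r => g r (u r)).eval s - g s (u s)| ≤ D₁)
    {Q : ℝ[X]} (hQ : Q.eval b = Q.eval a)
    (h₂ : ∀ s ∈ Icc a b, |(radauInterp k a b fun r => g r (u r)).eval s - g s (u s)
      - (derivative Q).eval s| ≤ D₂) :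
    (∀ s ∈ Icc a b, |W.eval s - u s| ≤ 2 * (|α - u a| + (b - a) * D₁)) ∧
    |W.eval b - u b| ≤
      |α - u a| + (b - a) * (Λ * L * (2 * (|α - u a| + (b - a) * D₁)) + D₂) := by
  have hba : 0 ≤ b - a := sub_nonneg.2 hab.le
  set v : ℝ → ℝ := fun r => g r (u r) with hv
  -- the part of `W' - u'` that comes from the error at the Radau zeros
  have hstab : ∀ M, (∀ z ∈ radauZeros k a b, |W.eval z - u z| ≤ M) → ∀ s ∈ Icc a b,
      |(derivative W).eval s - (radauInterp k a b v).eval s| ≤ Λ * (L * M) := by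
    intro M hM s hs
    rw [hW.derivative_eq, ← eval_sub, ← radauInterp_sub]
    refine hΛ hab _ _ (fun z hz => ?_) s hs
    exact (abs_sub_le_of_lipschitzWith (hg z (radauZeros_subset_Icc hab hz)) _ _).trans
      (mul_le_mul_of_nonneg_left (hM z hz) L.2)
  have hglobal : ∀ M, 0 ≤ M → (∀ z ∈ radauZeros k a b, |W.eval z - u z| ≤ M) →
      ∀ s ∈ Icc a b, |W.eval s - u s| ≤ |α - u a| + (b - a) * D₁ + M / 2 := by
    intro M hM0 hM s hs
    have h := abs_sub_le_of_hasDerivWithinAt (e := fun s => W.eval s - u s)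
      (e' := fun s => (derivative W).eval s - v s) (C := Λ * (L * M) + D₁)
      (fun s hs => (W.hasDerivWithinAt s _).sub (hu s hs)) (fun s hs => ?_) (by positivity) hs
    · rw [hW.eval_left] at h
      have h3 : (b - a) * (Λ * L) * M ≤ 1 / 2 * M := mul_le_mul_of_nonneg_right hsmall hM0
      have h4 := abs_sub_abs_le_abs_sub (W.eval s - u s) (α - u a)
      linarith
    · refine (abs_sub_le _ ((radauInterp k a b v).eval s) _).trans ?_
      exact add_le_add (hstab M hM s hs) (h₁ s hs)
  have hnodes : ∀ z ∈ radauZeros k a b,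
      |W.eval z - u z| ≤ 2 * (|α - u a| + (b - a) * D₁) :=
    abs_le_two_mul_of_forall_le (y := fun z => W.eval z - u z) fun M hM0 hM z hz =>
      hglobal M hM0 hM z (radauZeros_subset_Icc hab hz)
  constructor
  · intro s hs
    refine (hglobal _ (by positivity) hnodes s hs).trans (le_of_eq ?_)
    ring
  · have h := abs_sub_le_of_hasDerivWithinAt (e := fun s => W.eval s - u s - Q.eval s)
      (e' := fun s => (derivative W).eval s - v s - (derivative Q).eval s)
      (C := Λ * (L * (2 * (|α - u a| + (b - a) * D₁))) + D₂)
      (fun s hs => ((W.hasDerivWithinAt s _).sub (hu s hs)).sub (Q.hasDerivWithinAt s _))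
      (fun s hs => ?_) (by positivity) (right_mem_Icc.2 hab.le)
    · simp only [hQ, hW.eval_left, sub_sub_sub_cancel_right] at h
      have h4 := abs_sub_abs_le_abs_sub (W.eval b - u b) (α - u a)
      linarith
    · have h5 := (abs_add_le ((derivative W).eval s - (radauInterp k a b v).eval s)
        ((radauInterp k a b v).eval s - v s - (derivative Q).eval s)).trans
        (add_le_add (hstab _ hnodes s hs) (h₂ s hs))
      refine le_trans (le_of_eq ?_) h5
      congr 1
      ring

/-! ### The globally Lipschitz problem on a partition -/

/-- The methods march in time, so solvability on every interval with every initial value gives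
solvability on the partition. -/
theorem existsUnique_of_existsUnique_local {k N : ℕ} {t : Fin (N + 1) → ℝ}
    {g : ℝ → ℝ → ℝ}
    (h : ∀ n : Fin N, ∀ α, ∃! W : ℝ[X], IsCollocation k (t n.castSucc) (t n.succ) α g W)
    (u₀ : ℝ) :
    ∃! W : Fin N → ℝ[X], ∀ n,
      IsCollocation k (t n.castSucc) (t n.succ) (leftTrace t u₀ W n.castSucc) g (W n) := by
  choose S hS hSu using h
  let y : Fin (N + 1) → ℝ := Fin.induction u₀ fun n α => (S n α).eval (t n.succ)
  have hy : leftTrace t u₀ (fun n => S n (y n.castSucc)) = y := by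
    funext m
    exact Fin.cases rfl (fun n => rfl) m
  refine ⟨fun n => S n (y n.castSucc), fun n => ?_, fun V hV => ?_⟩
  · rw [hy]
    exact hS n _
  · have htr : ∀ m, leftTrace t u₀ V m = y m := by
      intro m
      induction m using Fin.induction with
      | zero => rfl
      | succ n ih =>
        have h1 : V n = S n (y n.castSucc) := by
          rw [← ih]
          exact hSu n _ _ (hV n)
        exact congrArg (fun p : ℝ[X] => p.eval (t n.succ)) h1
    funext n
    rw [← htr]
    exact hSu n _ _ (hV n)

theorem discrete_gronwall {N : ℕ} {t E : Fin (N + 1) → ℝ} {A B : ℝ} (hA : 0 ≤ A) (hB : 0 ≤ B)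
    (ht : Monotone t) (ht0 : t 0 = 0) (hE0 : E 0 = 0)
    (h : ∀ n : Fin N, E n.succ ≤ (1 + A * (t n.succ - t n.castSucc)) * E n.castSucc
      + B * (t n.succ - t n.castSucc)) (m : Fin (N + 1)) :
    E m ≤ B * t m * Real.exp (A * t m) := by
  have hpos : ∀ m, 0 ≤ t m := fun m => ht0 ▸ ht (Fin.zero_le m)
  induction m using Fin.induction with
  | zero => simp [hE0, ht0]
  | succ n ih =>
    set τ := t n.succ - t n.castSucc with hτ
    have hτ0 : 0 ≤ τ := sub_nonneg.2 (ht n.castSucc_lt_succ.le)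
    have h1 : 1 + A * τ ≤ Real.exp (A * τ) := by
      linarith [Real.add_one_le_exp (A * τ)]
    have h2 : Real.exp (A * t n.succ) = Real.exp (A * τ) * Real.exp (A * t n.castSucc) := by
      rw [← Real.exp_add]
      congr 1
      ring
    have h3 : 1 ≤ Real.exp (A * t n.succ) :=
      Real.one_le_exp (mul_nonneg hA (hpos _))
    have h0 := hpos n.castSucc
    calc E n.succ ≤ (1 + A * τ) * E n.castSucc + B * τ := h n
      _ ≤ (1 + A * τ) * (B * t n.castSucc * Real.exp (A * t n.castSucc)) + B * τ := by
          gcongr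
      _ ≤ Real.exp (A * τ) * (B * t n.castSucc * Real.exp (A * t n.castSucc))
            + B * τ * Real.exp (A * t n.succ) := by
          refine add_le_add (mul_le_mul_of_nonneg_right h1 (by positivity)) ?_
          exact le_mul_of_one_le_right (by positivity) h3
      _ = B * t n.succ * Real.exp (A * t n.succ) := by
          rw [h2]
          ring

theorem step_le_meshSize {N : ℕ} (t : Fin (N + 1) → ℝ) (n : Fin N) :
    t n.succ - t n.castSucc ≤ meshSize t :=
  le_ciSup (f := fun n : Fin N => t n.succ - t n.castSucc) (Set.finite_range _).bddAbove n

theorem IsPartition.Icc_subset {T : ℝ} {N : ℕ} {t : Fin (N + 1) → ℝ} (ht : IsPartition T t)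
    (n : Fin N) : Icc (t n.castSucc) (t n.succ) ⊆ Icc 0 T :=
  Icc_subset_Icc (ht.first ▸ ht.strictMono.monotone (Fin.zero_le _))
    (ht.last ▸ ht.strictMono.monotone (Fin.le_last _))

/-- Convergence of the collocation method for a globally Lipschitz right-hand side. -/
theorem exists_error_bound {k : ℕ} {Λ : ℝ} (hΛ : IsLebesgueBound k Λ) (hΛ0 : 0 ≤ Λ)
    {L : ℝ≥0} {T : ℝ} (hT : 0 < T) {g : ℝ → ℝ → ℝ}
    (hg : ∀ s ∈ Icc 0 T, LipschitzWith L (g s)) {u : ℝ → ℝ}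
    (hu : ∀ s ∈ Icc 0 T, HasDerivWithinAt u (g s (u s)) (Icc 0 T) s)
    (huc : ContDiffOn ℝ ((k + 3 : ℕ) : WithTop ℕ∞) u (Icc 0 T)) :
    ∃ K : ℝ, 0 ≤ K ∧ ∀ (N : ℕ) (t : Fin (N + 1) → ℝ), IsPartition T t → meshSize t ≤ 1 →
      meshSize t * (Λ * L) ≤ 1 / 2 → ∀ W : Fin N → ℝ[X],
      (∀ n, IsCollocation k (t n.castSucc) (t n.succ) (leftTrace t (u 0) W n.castSucc) g (W n)) →
      ∀ n, ∀ s ∈ Icc (t n.castSucc) (t n.succ),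
        |(W n).eval s - u s| ≤ K * meshSize t ^ nodeOrder k := by
  have hv : ContDiffOn ℝ ((k + 2 : ℕ) : WithTop ℕ∞) (fun s => g s (u s)) (Icc 0 T) := by
    have h := huc.derivWithin (m := ((k + 2 : ℕ) : WithTop ℕ∞)) (uniqueDiffOn_Icc hT)
      (by norm_cast)
    exact h.congr fun s hs => ((hu s hs).derivWithin (uniqueDiffOn_Icc hT s hs)).symm
  obtain ⟨D, hD, hbound⟩ := exists_interpolation_bound hΛ hΛ0 hT hv
  set A : ℝ := 2 * (Λ * L) with hA
  set B : ℝ := (A + 1) * D with hB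
  have hA0 : 0 ≤ A := by positivity
  have hB0 : 0 ≤ B := by positivity
  refine ⟨2 * (B * T * Real.exp (A * T) + D), by positivity, fun N t ht hm1 hm W hW n s hs => ?_⟩
  set H := meshSize t ^ nodeOrder k with hH
  have hstep : ∀ n : Fin N, 0 < t n.succ - t n.castSucc := fun n =>
    sub_pos.2 (ht.strictMono n.castSucc_lt_succ)
  have hH0 : 0 ≤ H := pow_nonneg ((hstep n).le.trans (step_le_meshSize t n)) _
  have hpow : ∀ n : Fin N, (t n.succ - t n.castSucc) ^ nodeOrder k ≤ H := fun n =>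
    pow_le_pow_left₀ (hstep n).le (step_le_meshSize t n) _
  -- the error made within one step has order `k + 2`, which is at least the order at the nodes
  have hpow' : ∀ n : Fin N,
      (t n.succ - t n.castSucc) * (D * (t n.succ - t n.castSucc) ^ (k + 1)) ≤ D * H := by
    intro n
    have h1 : (t n.succ - t n.castSucc) ^ (k + 2) ≤ (t n.succ - t n.castSucc) ^ nodeOrder k :=
      pow_le_pow_of_le_one (hstep n).le ((step_le_meshSize t n).trans hm1)
        (by unfold nodeOrder; split_ifs <;> omega)
    calc _ = D * (t n.succ - t n.castSucc) ^ (k + 2) := by ring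
      _ ≤ D * H := mul_le_mul_of_nonneg_left (h1.trans (hpow n)) hD
  have hlocal : ∀ n : Fin N,
      (∀ s ∈ Icc (t n.castSucc) (t n.succ), |(W n).eval s - u s| ≤
        2 * (|leftTrace t (u 0) W n.castSucc - u (t n.castSucc)| + D * H)) ∧
      |(W n).eval (t n.succ) - u (t n.succ)| ≤
        (1 + A * (t n.succ - t n.castSucc)) *
            |leftTrace t (u 0) W n.castSucc - u (t n.castSucc)|
          + B * H * (t n.succ - t n.castSucc) := by
    intro n
    have hsub := ht.Icc_subset n
    obtain ⟨h₁, Q, hQ, h₂⟩ := hbound _ _ (ht.strictMono n.castSucc_lt_succ) hsub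
    have hs0 := (hstep n).le
    obtain ⟨e₁, e₂⟩ := abs_eval_sub_le hΛ hΛ0 (ht.strictMono n.castSucc_lt_succ)
      ((mul_le_mul_of_nonneg_right (step_le_meshSize t n) (by positivity)).trans hm)
      (fun s hs => hg s (hsub hs)) (fun s hs => (hu s (hsub hs)).mono hsub) (hW n)
      (by positivity) (by positivity) h₁ hQ h₂
    constructor
    · intro s hs
      refine (e₁ s hs).trans ?_
      have := hpow' n
      linarith
    · refine e₂.trans ?_
      have h3 := mul_le_mul_of_nonneg_left (hpow' n) (mul_nonneg hs0 hA0)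
      have h4 := mul_le_mul_of_nonneg_left
        (mul_le_mul_of_nonneg_left (hpow n) hD) hs0
      rw [hA] at h3
      rw [hB, hA]
      linarith
  have hnode : ∀ m, |leftTrace t (u 0) W m - u (t m)| ≤ B * H * t m * Real.exp (A * t m) := by
    refine discrete_gronwall hA0 (by positivity) ht.strictMono.monotone ht.first ?_ fun n => ?_
    · simp [leftTrace, ht.first]
    · exact (hlocal n).2
  have hmem : t n.castSucc ∈ Icc 0 T :=
    ht.Icc_subset n (left_mem_Icc.2 (sub_nonneg.1 (hstep n).le))
  have h5 : B * H * t n.castSucc * Real.exp (A * t n.castSucc)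
      ≤ B * H * T * Real.exp (A * T) := by
    have h6 := hmem.1
    have h7 := hmem.2
    gcongr
  have h8 := (hlocal n).1 s hs
  have h9 := hnode n.castSucc
  calc _ ≤ _ := h8
    _ ≤ 2 * (B * H * T * Real.exp (A * T) + D * H) := by linarith
    _ = _ := by ring

/-! ### Localisation -/

/-- A right-hand side that is Lipschitz near `u` extends from the neighbourhood of `u` to a
globally Lipschitz one. -/
theorem exists_lipschitzWith_extension {S : Set ℝ} {f : ℝ → ℝ → ℝ} {u : ℝ → ℝ} {δ : ℝ≥0∞}
    {L : ℝ≥0} (h : ∀ s ∈ S, LipschitzOnWith L (f s) {x | edist x (u s) ≤ δ}) :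
    ∃ g : ℝ → ℝ → ℝ, ∀ s ∈ S, LipschitzWith L (g s) ∧ ∀ x, edist x (u s) ≤ δ → f s x = g s x := by
  have hex : ∀ s, ∃ gs : ℝ → ℝ, s ∈ S →
      LipschitzWith L gs ∧ ∀ x, edist x (u s) ≤ δ → f s x = gs x := by
    intro s
    by_cases hs : s ∈ S
    · obtain ⟨gs, h1, h2⟩ := (h s hs).extend_real
      exact ⟨gs, fun _ => ⟨h1, fun x hx => h2 hx⟩⟩
    · exact ⟨0, fun hs' => absurd hs' hs⟩
  choose g hg using hex
  exact ⟨g, hg⟩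

theorem IsNear.isCGSolution_congr {k N : ℕ} {T u₀ : ℝ} {t : Fin (N + 1) → ℝ}
    (ht : IsPartition T t) {f g : ℝ → ℝ → ℝ} {u : ℝ → ℝ} {δ : ℝ≥0∞} {W : Fin N → ℝ[X]}
    (hW : IsNear k t u δ W)
    (hfg : ∀ s ∈ Icc 0 T, ∀ x, edist x (u s) ≤ δ → f s x = g s x) :
    IsCGSolution k t u₀ f W ↔ IsCGSolution k t u₀ g W := by
  have hI : ∀ n, (radauInterp k (t n.castSucc) (t n.succ) fun r => f r ((W n).eval r)) =
      radauInterp k (t n.castSucc) (t n.succ) fun r => g r ((W n).eval r) := fun n =>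
    radauInterp_congr fun z hz => hfg z (ht.Icc_subset n
      (radauZeros_subset_Icc (ht.strictMono n.castSucc_lt_succ) hz)) _ (hW n z hz)
  constructor
  · exact fun h => ⟨h.natDegree_le, fun n v hv => by rw [← hI]; exact h.weak n v hv,
      h.continuous_at_nodes⟩
  · exact fun h => ⟨h.natDegree_le, fun n v hv => by rw [hI]; exact h.weak n v hv,
      h.continuous_at_nodes⟩

theorem isNear_postProcess_iff {k N : ℕ} {T u₀ : ℝ} {t : Fin (N + 1) → ℝ}
    (ht : IsPartition T t) {u : ℝ → ℝ} {δ : ℝ≥0∞} {U : Fin N → ℝ[X]} :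
    IsNear k t u δ (postProcess k t u₀ U) ↔ IsNear k t u δ U :=
  forall_congr' fun n => forall₂_congr fun z hz => by rw [postProcess_eval_of_mem ht U n hz]

/-- Near `u` the CG method has exactly one solution on every fine partition, and it converges
uniformly. -/
theorem exists_cg_solution_near {k : ℕ} {T : ℝ} (hT : 0 < T) {f : ℝ → ℝ → ℝ} {u : ℝ → ℝ}
    {δ : ℝ≥0∞} {L : ℝ≥0} (hδ : 0 < δ)
    (hu : ∀ s ∈ Icc (0 : ℝ) T, HasDerivWithinAt u (f s (u s)) (Icc 0 T) s)
    (huc : ContDiffOn ℝ ((k + 3 : ℕ) : WithTop ℕ∞) u (Icc 0 T))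
    (hf : ∀ s ∈ Icc (0 : ℝ) T, LipschitzOnWith L (f s) {x | edist x (u s) ≤ δ}) :
    ∃ h₀ > (0 : ℝ), ∃ K : ℝ, ∀ (N : ℕ) (t : Fin (N + 1) → ℝ), IsPartition T t →
      meshSize t ≤ h₀ → ∃ W : Fin N → ℝ[X],
        (IsCGSolution k t (u 0) f W ∧ IsNear k t u δ W) ∧
        (∀ W', IsCGSolution k t (u 0) f W' → IsNear k t u δ W' → W' = W) ∧
        ∀ n, ∀ s ∈ Icc (t n.castSucc) (t n.succ),
          |(W n).eval s - u s| ≤ K * meshSize t ^ nodeOrder k := by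
  obtain ⟨Λ, hΛ0, hΛ⟩ := exists_isLebesgueBound k
  obtain ⟨g, hg⟩ := exists_lipschitzWith_extension hf
  have hgL : ∀ s ∈ Icc 0 T, LipschitzWith L (g s) := fun s hs => (hg s hs).1
  have hfg : ∀ s ∈ Icc 0 T, ∀ x, edist x (u s) ≤ δ → f s x = g s x := fun s hs => (hg s hs).2
  have hug : ∀ s ∈ Icc 0 T, HasDerivWithinAt u (g s (u s)) (Icc 0 T) s := fun s hs => by
    rw [← hfg s hs (u s) (by simp)]
    exact hu s hs
  obtain ⟨K, hK0, hK⟩ := exists_error_bound hΛ hΛ0 hT hgL hug huc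
  -- a real radius inside the neighbourhood on which `f` and `g` agree
  obtain ⟨d, hd0, hdδ⟩ := ENNReal.lt_iff_exists_nnreal_btwn.1 hδ
  have hd : (0 : ℝ) < d := by exact_mod_cast hd0
  refine ⟨min 1 (min (1 / (2 * (Λ * L + 1))) (d / (K + 1))), by positivity, K,
    fun N t ht hmesh => ?_⟩
  have hm1 : meshSize t ≤ 1 := hmesh.trans (min_le_left _ _)
  have hm2 : meshSize t ≤ 1 / (2 * (Λ * L + 1)) :=
    hmesh.trans ((min_le_right _ _).trans (min_le_left _ _))
  have hm3 : meshSize t ≤ d / (K + 1) :=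
    hmesh.trans ((min_le_right _ _).trans (min_le_right _ _))
  have hm0 : 0 ≤ meshSize t :=
    Real.iSup_nonneg fun n => sub_nonneg.2 (ht.strictMono n.castSucc_lt_succ).le
  have hΛL : 0 ≤ Λ * L := by positivity
  have hsmall : meshSize t * (Λ * L) ≤ 1 / 2 := by
    rw [le_div_iff₀ (by positivity)] at hm2
    linarith
  have hKm : K * meshSize t ^ nodeOrder k ≤ d := by
    have h1 : meshSize t ^ nodeOrder k ≤ meshSize t :=
      pow_le_of_le_one hm0 hm1 (by unfold nodeOrder; split_ifs <;> omega)
    rw [le_div_iff₀ (by positivity)] at hm3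
    have h2 := mul_le_mul_of_nonneg_left h1 hK0
    linarith
  have hloc : ∀ n : Fin N, ∀ α,
      ∃! W : ℝ[X], IsCollocation k (t n.castSucc) (t n.succ) α g W := fun n α =>
    existsUnique_isCollocation hΛ hΛ0 (ht.strictMono n.castSucc_lt_succ)
      ((mul_le_mul_of_nonneg_right (step_le_meshSize t n) hΛL).trans hsmall)
      (fun s hs => hgL s (ht.Icc_subset n hs)) α
  obtain ⟨W, hW, hWu⟩ := existsUnique_of_existsUnique_local hloc (u 0)
  have herr := hK N t ht hm1 hsmall W hW
  have hnear : IsNear k t u δ W := by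
    intro n z hz
    have h1 := (herr n z
      (radauZeros_subset_Icc (ht.strictMono n.castSucc_lt_succ) hz)).trans hKm
    rw [edist_dist, Real.dist_eq]
    refine le_trans ?_ hdδ.le
    rw [← ENNReal.ofReal_coe_nnreal]
    exact ENNReal.ofReal_le_ofReal h1
  refine ⟨W, ⟨(hnear.isCGSolution_congr ht hfg).2 ((isCGSolution_iff ht).2 hW), hnear⟩,
    fun V hV hVnear => ?_, herr⟩
  exact hWu V ((isCGSolution_iff ht).1 ((hVnear.isCGSolution_congr ht hfg).1 hV))

end Galerkin

theorem corollary3p1 (k : ℕ) (T : ℝ) (hT : 0 < T) (u₀ : ℝ) (f : ℝ → ℝ → ℝ) :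
    -- on every partition: the Radau zeros, and DG/CG solutions correspond by post-processing
    (∀ (N : ℕ) (t : Fin (N + 1) → ℝ), Galerkin.IsPartition T t →
      (∀ n : Fin N,
        (Galerkin.radauZeros k (t n.castSucc) (t n.succ)).card = k + 1 ∧
        ∀ z ∈ Galerkin.radauZeros k (t n.castSucc) (t n.succ),
          z ∈ Ioc (t n.castSucc) (t n.succ)) ∧
      BijOn (Galerkin.postProcess k t u₀)
        {U | Galerkin.IsDGSolution k t u₀ f U} {W | Galerkin.IsCGSolution k t u₀ f W}) ∧
    -- well-posedness, equality and convergence on fine partitions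
    (∀ (u : ℝ → ℝ) (δ : ℝ≥0∞) (L : ℝ≥0), 0 < δ →
      u 0 = u₀ →
      (∀ s ∈ Icc (0 : ℝ) T, HasDerivWithinAt u (f s (u s)) (Icc 0 T) s) →
      ContDiffOn ℝ ((k + 3 : ℕ) : WithTop ℕ∞) u (Icc 0 T) →
      (∀ s ∈ Icc (0 : ℝ) T, LipschitzOnWith L (f s) {x | edist x (u s) ≤ δ}) →
      ∃ h₀ > (0 : ℝ), ∃ K : ℝ,
        ∀ (N : ℕ) (t : Fin (N + 1) → ℝ), Galerkin.IsPartition T t → Galerkin.meshSize t ≤ h₀ →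
          ∃ U W : Fin N → ℝ[X],
            -- `U` is the DG solution and `W` the CG solution
            (Galerkin.IsDGSolution k t u₀ f U ∧ Galerkin.IsNear k t u δ U) ∧
            (∀ U', Galerkin.IsDGSolution k t u₀ f U' → Galerkin.IsNear k t u δ U' → U' = U) ∧
            (Galerkin.IsCGSolution k t u₀ f W ∧ Galerkin.IsNear k t u δ W) ∧
            (∀ W', Galerkin.IsCGSolution k t u₀ f W' → Galerkin.IsNear k t u δ W' → W' = W) ∧
            -- (1)
            Galerkin.postProcess k t u₀ U = W ∧
            -- (2)
            (0 < k → ∀ n : Fin N, ∀ s ∈ Icc (t n.castSucc) (t n.succ),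
              |(Galerkin.postProcess k t u₀ U n).eval s - u s|
                ≤ K * Galerkin.meshSize t ^ (k + 2)) ∧
            -- (3)
            (0 < k → ∀ n : Fin N, ∀ z ∈ Galerkin.radauZeros k (t n.castSucc) (t n.succ),
              |(U n).eval z - u z| ≤ K * Galerkin.meshSize t ^ (k + 2))) := by
  refine ⟨fun N t ht => ⟨fun n =>
    Galerkin.card_radauZeros_and_mem (ht.strictMono n.castSucc_lt_succ),
    Galerkin.bijOn_postProcess ht⟩, ?_⟩
  rintro u δ L hδ rfl hu huc hf
  obtain ⟨h₀, hh₀, K, hK⟩ := Galerkin.exists_cg_solution_near hT hδ hu huc hf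
  refine ⟨h₀, hh₀, K, fun N t ht hmesh => ?_⟩
  obtain ⟨W, ⟨hW, hWnear⟩, hWu, herr⟩ := hK N t ht hmesh
  have hbij := Galerkin.bijOn_postProcess (k := k) (u₀ := u 0) (f := f) ht
  obtain ⟨U, hU, hUW⟩ := hbij.surjOn hW
  have hUnear : Galerkin.IsNear k t u δ U := by
    rw [← Galerkin.isNear_postProcess_iff (u₀ := u 0) ht, hUW]
    exact hWnear
  refine ⟨U, W, ⟨hU, hUnear⟩, fun U' hU' hU'near => ?_, ⟨hW, hWnear⟩, hWu, hUW,
    fun hk n s hs => ?_, fun hk n z hz => ?_⟩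
  · refine hbij.injOn hU' hU ?_
    rw [hUW]
    exact hWu _ (hbij.mapsTo hU') ((Galerkin.isNear_postProcess_iff ht).2 hU'near)
  · have h := herr n s hs
    rwa [← hUW, Galerkin.nodeOrder, if_neg hk.ne'] at h
  · have h := herr n z
      (Galerkin.radauZeros_subset_Icc (ht.strictMono n.castSucc_lt_succ) hz)
    rwa [← hUW, Galerkin.nodeOrder, if_neg hk.ne', Galerkin.postProcess_eval_of_mem ht U n hz] at h
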